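/- A word over a finite set $V$ is a finite sequence of elements of $V$. Two distinct letters $x,y\in V$ \emph{alternate} in a word $w$ if no two instances of $x$, and no two instances of $y$, occur in $w$ without an occurrence of the other letter in between. A word $w$ over $V$ \emph{word-represents} a simple graph $G=(V,E)$ if every element of $V$ occurs in $w$ at least once and, for all distinct $x,y\in V$, $xy\in E$ if and only if $x$ and $y$ alternate in $w$; the graph $G$ is \emph{word-representable} if such a word exists. For a word-representable graph $G$, let $\ell(G)$ be the minimal length of a word that word-represents $G$, and let $n(G)$ be the number of words of length $\ell(G)$ that word-represent $G$. Let $k\ge 3$ and let $P_k$ be the path on $k$ (labelled) vertices. Then $P_k$ is word-representable, and $$n(P_k)=(k+1)\cdot 2^{k-3}.$$ -/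

import Mathlib

namespace WordRep

/-- Two letters `x` and `y` alternate in the word `w`: in the word obtained from `w` by deleting
every letter other than `x` and `y`, no two consecutive letters are equal; that is, there are no
two instances of `x` (or of `y`) without an occurrence of the other letter in between. -/
def Alternate {V : Type*} [DecidableEq V] (w : List V) (x y : V) : Prop :=
  (w.filter (fun z => z = x ∨ z = y)).IsChain (· ≠ ·)

/-- The word `w` over the alphabet `V` word-represents the graph `G`: it contains every vertex at
least once, and two distinct vertices are adjacent exactly when they alternate in `w`. -/
def Represents {V : Type*} [DecidableEq V] (w : List V) (G : SimpleGraph V) : Prop :=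
  (∀ v : V, v ∈ w) ∧ ∀ x y : V, x ≠ y → (G.Adj x y ↔ Alternate w x y)

/-- The minimal length of a word-representant of `G` (meaningful for word-representable `G`). -/
noncomputable def minLength {V : Type*} [DecidableEq V] (G : SimpleGraph V) : ℕ :=
  sInf {m : ℕ | ∃ w : List V, Represents w G ∧ w.length = m}

/-- The number of word-representants of `G` of minimal length. -/
noncomputable def numMinReps {V : Type*} [DecidableEq V] (G : SimpleGraph V) : ℕ :=
  Set.ncard {w : List V | Represents w G ∧ w.length = minLength G}

end WordRep

namespace WordRep

/-! Letters occurring once alternate pairwise, so they are pairwise adjacent, and a path allows at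
most two of them. Hence a representant has length at least `2 * k - 2`, and at equality two
consecutive vertices occur once and all others twice.

If the end vertex `k + 1` is doubled, its occurrences enclose a single `k`
(`MinPathRep.exists_insertion`). Deleting them leaves a minimal representant of the shorter path
with a marked occurrence of `k`, and this is reversible. Let `N`, `D`, `S` count minimal
representants with last vertex `k`: all, those with `k` doubled, those with `k` single. Counting
marks gives `D (k + 1) = N k + D k`, where `N = S + D`. Reflecting the path turns `S` into the count
with `0` and `1` single, which doubles at each step by the same recursion. Solving gives the
formula. -/

lemma isChain_ne_replicate {V : Type*} {b : V} {n : ℕ} :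
    (List.replicate n b).IsChain (· ≠ ·) ↔ n ≤ 1 := by
  rcases n with _ | _ | n <;> simp [List.replicate_succ]

/-! ### Alternation read off from the positions of one letter -/

section Alternation

variable {V : Type*} [DecidableEq V]

lemma alternate_comm {w : List V} {x y : V} : Alternate w x y ↔ Alternate w y x := by
  unfold Alternate
  simp only [or_comm]

lemma alternate_map {U : Type*} [DecidableEq U] {f : U → V} (hf : Function.Injective f)
    (w : List U) (x y : U) : Alternate (w.map f) (f x) (f y) ↔ Alternate w x y := by
  unfold Alternate
  rw [List.filter_map, List.isChain_map]
  simp only [Function.comp_def, hf.eq_iff, hf.ne_iff]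

lemma filter_pair_of_notMem {a b : V} {l : List V} (h : a ∉ l) :
    l.filter (fun z => z = a ∨ z = b) = List.replicate (l.count b) b := by
  rw [← List.filter_eq]
  apply List.filter_congr
  intro z hz
  have : z ≠ a := fun e => h (e ▸ hz)
  simp [this, eq_comm]

lemma alternate_split_one {a b : V} (hab : a ≠ b) {l r : List V} (hl : a ∉ l) (hr : a ∉ r) :
    Alternate (l ++ a :: r) a b ↔ l.count b ≤ 1 ∧ r.count b ≤ 1 := by
  unfold Alternate
  rw [List.filter_append, List.filter_cons_of_pos (by simp), filter_pair_of_notMem hl,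
    filter_pair_of_notMem hr, List.isChain_append, List.isChain_cons, isChain_ne_replicate,
    isChain_ne_replicate]
  simp [List.head?_replicate, List.getLast?_replicate, hab, hab.symm]

lemma alternate_split_two {a b : V} (hab : a ≠ b) {l m r : List V} (hl : a ∉ l) (hm : a ∉ m)
    (hr : a ∉ r) : Alternate (l ++ a :: (m ++ a :: r)) a b ↔
      l.count b ≤ 1 ∧ m.count b = 1 ∧ r.count b ≤ 1 := by
  unfold Alternate
  rw [List.filter_append, List.filter_cons_of_pos (by simp), List.filter_append,
    List.filter_cons_of_pos (by simp), filter_pair_of_notMem hl,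
    filter_pair_of_notMem hm, filter_pair_of_notMem hr, List.isChain_append, List.isChain_cons,
    List.isChain_append, List.isChain_cons, isChain_ne_replicate,
    isChain_ne_replicate, isChain_ne_replicate]
  rcases h : m.count b with _ | _ | n <;>
    simp [List.head?_replicate, List.getLast?_replicate, hab, hab.symm]

lemma alternate_of_count_eq_one {a b : V} (hab : a ≠ b) {w : List V} (ha : w.count a = 1)
    (hb : w.count b = 1) : Alternate w a b := by
  obtain ⟨l, r, rfl⟩ := List.append_of_mem (List.count_pos_iff.1 (by omega : 0 < w.count a))
  simp only [List.count_append, List.count_cons, beq_self_eq_true, if_true] at ha hb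
  rw [alternate_split_one hab (List.count_eq_zero.1 (by omega)) (List.count_eq_zero.1 (by omega))]
  omega

lemma exists_split_of_count_eq_two {a : V} {w : List V} (ha : w.count a = 2) :
    ∃ l m r, w = l ++ a :: (m ++ a :: r) ∧ a ∉ l ∧ a ∉ m ∧ a ∉ r := by
  obtain ⟨l, s, rfl, hl⟩ :=
    List.eq_append_cons_of_mem (List.count_pos_iff.1 (by omega : 0 < w.count a))
  have hl0 := List.count_eq_zero.2 hl
  simp only [List.count_append, List.count_cons, beq_self_eq_true, if_true] at ha
  obtain ⟨m, r, rfl, hm⟩ :=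
    List.eq_append_cons_of_mem (List.count_pos_iff.1 (by omega : 0 < s.count a))
  simp only [List.count_append, List.count_cons, beq_self_eq_true, if_true] at ha
  exact ⟨l, m, r, rfl, hl, hm, List.count_eq_zero.1 (by omega)⟩

lemma mem_infix_of_alternate {x y : V} (hxy : x ≠ y) {p m q : List V} (hm : m.count x = 2)
    (hp : x ∉ p) (hq : x ∉ q) (h : Alternate (p ++ (m ++ q)) x y) : y ∈ m := by
  obtain ⟨m₁, m₂, m₃, rfl, h₁, h₂, h₃⟩ := exists_split_of_count_eq_two hm
  have e : p ++ ((m₁ ++ x :: (m₂ ++ x :: m₃)) ++ q) =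
      (p ++ m₁) ++ x :: (m₂ ++ x :: (m₃ ++ q)) := by simp
  rw [e, alternate_split_two hxy (by simp [hp, h₁]) h₂ (by simp [hq, h₃])] at h
  have : y ∈ m₂ := List.count_pos_iff.1 (by omega)
  simp [this]

/-- Deleting a letter does not affect the alternation of two other letters. -/
lemma alternate_filter_ne {a x y : V} (hx : x ≠ a) (hy : y ≠ a) (w : List V) :
    Alternate (w.filter (fun z => z ≠ a)) x y ↔ Alternate w x y := by
  unfold Alternate
  rw [List.filter_filter]
  have : ∀ z, (decide (z = x ∨ z = y) && decide (z ≠ a)) = decide (z = x ∨ z = y) := by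
    intro z
    by_cases h : z = x ∨ z = y
    · rcases h with rfl | rfl <;> simp [hx, hy]
    · simp [h]
  simp only [this]

lemma filter_ne_insertion {a b : V} (hab : b ≠ a) {l r : List V} (hl : a ∉ l) (hr : a ∉ r) :
    (l ++ a :: b :: a :: r).filter (fun z => z ≠ a) = l ++ b :: r := by
  have key : ∀ s : List V, a ∉ s → s.filter (fun z => z ≠ a) = s := fun s hs =>
    List.filter_eq_self.2 fun z hz => decide_eq_true (ne_of_mem_of_not_mem hz hs)
  rw [List.filter_append, key l hl, List.filter_cons_of_neg (by simp),
    List.filter_cons_of_pos (by simpa using hab), List.filter_cons_of_neg (by simp), key r hr]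

end Alternation

/-! ### Letter counts and the length bound -/

/-- The word `w` represents the path `0 - 1 - ⋯ - (k - 1)` on the natural numbers below `k`. -/
def PathRep (k : ℕ) (w : List ℕ) : Prop :=
  (∀ v, v ∈ w ↔ v < k) ∧ ∀ x y, x < y → y < k → (x + 1 = y ↔ Alternate w x y)

/-- The words of length `2 * k - 2` that represent the path on `k` vertices. -/
def MinPathRep (k : ℕ) (w : List ℕ) : Prop :=
  PathRep k w ∧ w.length + 2 = 2 * k

lemma PathRep.length_eq_sum {k : ℕ} {w : List ℕ} (h : PathRep k w) :
    w.length = ∑ v ∈ Finset.range k, w.count v := by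
  have : w.toFinset = Finset.range k := by
    ext v; simp [h.1 v]
  rw [← this, List.sum_toFinset_count_eq_length]

lemma PathRep.count_pos {k : ℕ} {w : List ℕ} (h : PathRep k w) {v : ℕ} (hv : v < k) :
    0 < w.count v := List.count_pos_iff.2 ((h.1 v).2 hv)

lemma PathRep.succ_eq_of_count_eq_one {k : ℕ} {w : List ℕ} (h : PathRep k w) {x y : ℕ}
    (hxy : x < y) (hy : y < k) (hx1 : w.count x = 1) (hy1 : w.count y = 1) : x + 1 = y :=
  (h.2 x y hxy hy).2 (alternate_of_count_eq_one hxy.ne hx1 hy1)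

lemma PathRep.card_singles_le {k : ℕ} {w : List ℕ} (h : PathRep k w) :
    ((Finset.range k).filter (fun v => w.count v = 1)).card ≤ 2 := by
  rcases ((Finset.range k).filter (fun v => w.count v = 1)).eq_empty_or_nonempty with h0 | hne
  · simp [h0]
  · have hmem := Finset.min'_mem _ hne
    set p := ((Finset.range k).filter (fun v => w.count v = 1)).min' hne with hp
    simp only [Finset.mem_filter, Finset.mem_range] at hmem
    refine (Finset.card_le_card (t := {p, p + 1}) ?_).trans Finset.card_le_two
    intro v hv
    have hle := Finset.min'_le _ v hv
    rw [← hp] at hle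
    simp only [Finset.mem_filter, Finset.mem_range] at hv
    rcases hle.eq_or_lt with e | hlt
    · simp [e]
    · simp [h.succ_eq_of_count_eq_one hlt hv.1 hmem.2 hv.2]

/-- With truncated subtraction, `2 + (c - 2) = c + [c = 1]` for every `c ≥ 1`; sum over the
vertices. -/
lemma PathRep.two_mul_add_sum_eq {k : ℕ} {w : List ℕ} (h : PathRep k w) :
    2 * k + ∑ v ∈ Finset.range k, (w.count v - 2) =
      w.length + ((Finset.range k).filter (fun v => w.count v = 1)).card := by
  have h2 : 2 * k = ∑ v ∈ Finset.range k, 2 := by simp [mul_comm]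
  rw [h.length_eq_sum, Finset.card_filter, h2, ← Finset.sum_add_distrib, ← Finset.sum_add_distrib]
  refine Finset.sum_congr rfl fun v hv => ?_
  have := h.count_pos (Finset.mem_range.1 hv)
  split_ifs <;> omega

lemma PathRep.le_length {k : ℕ} {w : List ℕ} (h : PathRep k w) : 2 * k ≤ w.length + 2 := by
  have := h.two_mul_add_sum_eq
  have := h.card_singles_le
  omega

lemma MinPathRep.count_le_two {k : ℕ} {w : List ℕ} (h : MinPathRep k w) (v : ℕ) :
    w.count v ≤ 2 := by
  by_cases hv : v < k
  · have h1 := h.1.two_mul_add_sum_eq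
    have h2 := h.1.card_singles_le
    have h3 := h.2
    have h4 : ∑ v ∈ Finset.range k, (w.count v - 2) = 0 := by omega
    have := Finset.sum_eq_zero_iff.1 h4 v (Finset.mem_range.2 hv)
    omega
  · rw [List.count_eq_zero.2 (fun hm => hv ((h.1.1 v).1 hm))]
    omega

lemma MinPathRep.exists_singles {k : ℕ} {w : List ℕ} (h : MinPathRep k w) :
    ∃ p, p + 1 < k ∧ w.count p = 1 ∧ w.count (p + 1) = 1 := by
  have h1 := h.1.two_mul_add_sum_eq
  have h3 := h.2
  obtain ⟨a, ha, b, hb, hab⟩ := Finset.one_lt_card.1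
    (by omega : 1 < ((Finset.range k).filter (fun v => w.count v = 1)).card)
  simp only [Finset.mem_filter, Finset.mem_range] at ha hb
  rcases hab.lt_or_gt with hlt | hlt
  · obtain rfl := h.1.succ_eq_of_count_eq_one hlt hb.1 ha.2 hb.2
    exact ⟨a, hb.1, ha.2, hb.2⟩
  · obtain rfl := h.1.succ_eq_of_count_eq_one hlt ha.1 hb.2 ha.2
    exact ⟨b, ha.1, hb.2, ha.2⟩

/-! ### Removing and inserting a doubled end vertex -/

/-- In a minimal representant of the path on `k + 2` vertices in which the last vertex occurs
twice, its two occurrences are the neighbours of an occurrence of the last but one vertex. -/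
lemma MinPathRep.exists_insertion {k : ℕ} {w : List ℕ} (h : MinPathRep (k + 2) w)
    (hc : w.count (k + 1) = 2) :
    ∃ l r, MinPathRep (k + 1) (l ++ k :: r) ∧ w = l ++ (k + 1) :: k :: (k + 1) :: r := by
  obtain ⟨l, m, r, rfl, hl, hm, hr⟩ := exists_split_of_count_eq_two hc
  have hcnt : ∀ x, x ≠ k + 1 → (l ++ (k + 1) :: (m ++ (k + 1) :: r)).count x =
      l.count x + m.count x + r.count x := by
    intro x hx
    simp [List.count_append, hx.symm]
    omega
  have hk : m.count k = 1 := by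
    have := (h.1.2 k (k + 1) (by omega) (by omega)).1 rfl
    rw [alternate_comm, alternate_split_two (by omega) hl hm hr] at this
    exact this.2.1
  -- One occurrence inside `m` leaves at most one outside, so `x` would alternate with the
  -- non-adjacent `k + 1`.
  have hne1 : ∀ x < k, m.count x ≠ 1 := by
    intro x hx h1
    have h2 := h.count_le_two x
    rw [hcnt x (by omega)] at h2
    have := (h.1.2 x (k + 1) (by omega) (by omega)).2 (by
      rw [alternate_comm, alternate_split_two (by omega) hl hm hr]
      omega)
    omega
  have htwo : ∀ x < k, x ∈ m → m.count x = 2 ∧ l.count x = 0 ∧ r.count x = 0 := by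
    intro x hx hxm
    have h1 := hne1 x hx
    have h2 := h.count_le_two x
    have h3 := List.count_pos_iff.2 hxm
    rw [hcnt x (by omega)] at h2
    omega
  -- Both copies of `x` lie in `m`, and an alternating `y` must occur between them.
  have hstep : ∀ x y, x < k → x ∈ m → x ≠ y →
      Alternate (l ++ (k + 1) :: (m ++ (k + 1) :: r)) x y → y ∈ m := by
    intro x y hx hxm hxy ha
    obtain ⟨h1, h2, h3⟩ := htwo x hx hxm
    rw [List.count_eq_zero] at h2 h3
    refine mem_infix_of_alternate hxy (p := l ++ [k + 1]) (q := (k + 1) :: r) h1 ?_ ?_ ?_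
    · simp [h2]; omega
    · simp [h3]; omega
    · simpa using ha
  have hdown : ∀ d x, x + d < k → x + d ∈ m → x ∈ m := by
    intro d
    induction d with
    | zero => intro x _ hx; exact hx
    | succ d ih =>
      intro x hx hxm
      refine ih x (by omega) (hstep _ _ hx hxm (by omega) ?_)
      rw [alternate_comm]
      exact (h.1.2 _ _ (by omega) (by omega)).1 (by omega)
  have hup : ∀ d x, x + d < k → x ∈ m → x + d ∈ m := by
    intro d
    induction d with
    | zero => intro x _ hx; exact hx
    | succ d ih =>
      intro x hx hxm
      exact hstep _ _ (by omega) (ih x (by omega) hxm) (by omega)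
        ((h.1.2 _ _ (by omega) (by omega)).1 (by omega))
  -- Membership in `m` spreads along the path to a vertex `p` occurring once, yet vertices below `k`
  -- in `m` occur twice.
  have hnot : ∀ x < k, x ∉ m := by
    intro x hx hxm
    obtain ⟨p, hp, hp1, hp2⟩ := h.exists_singles
    have hpk : p < k := by
      by_contra hcon
      obtain rfl : p = k := by omega
      omega
    have hpm : p ∈ m := by
      rcases le_total x p with hle | hle
      · obtain ⟨d, rfl⟩ := Nat.exists_eq_add_of_le hle
        exact hup d x hpk hxm
      · obtain ⟨d, rfl⟩ := Nat.exists_eq_add_of_le hle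
        exact hdown d p hx hxm
    have := (htwo p hpk hpm).1
    rw [hcnt p (by omega)] at hp1
    omega
  have hmk : ∀ x ∈ m, x = k := by
    intro x hx
    have h1 : x < k + 2 := (h.1.1 x).1 (by simp [hx])
    have h2 : ¬ x < k := fun hlt => hnot x hlt hx
    have h3 : x ≠ k + 1 := fun e => hm (e ▸ hx)
    omega
  have hm' : m = [k] := by
    rw [List.eq_replicate_of_mem hmk] at hk ⊢
    rw [List.count_replicate_self] at hk
    rw [hk]; rfl
  subst hm'
  refine ⟨l, r, ⟨⟨?_, ?_⟩, ?_⟩, by simp⟩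
  · intro v
    have := h.1.1 v
    constructor
    · intro hv
      have h1 : v < k + 2 := this.1 (by simp at hv ⊢; tauto)
      have h2 : v ≠ k + 1 := by
        rintro rfl
        simp [hl, hr] at hv
      omega
    · intro hv
      have h1 := this.2 (by omega)
      simp at h1 ⊢
      grind
  · intro x y hxy hy
    rw [h.1.2 x y hxy (by omega), ← alternate_filter_ne (a := k + 1) (by omega) (by omega)]
    rw [List.singleton_append, filter_ne_insertion (by omega) hl hr]
  · have := h.2
    simp at this ⊢
    omega

lemma MinPathRep.insertion {k : ℕ} {l r : List ℕ} (h : MinPathRep (k + 1) (l ++ k :: r)) :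
    MinPathRep (k + 2) (l ++ (k + 1) :: k :: (k + 1) :: r) := by
  have hl : k + 1 ∉ l := fun hm => by
    have := (h.1.1 (k + 1)).1 (by simp [hm]); omega
  have hr : k + 1 ∉ r := fun hm => by
    have := (h.1.1 (k + 1)).1 (by simp [hm]); omega
  refine ⟨⟨?_, ?_⟩, ?_⟩
  · intro v
    have := h.1.1 v
    simp only [List.mem_append, List.mem_cons] at this ⊢
    grind
  · intro x y hxy hy
    rcases (by omega : y < k + 1 ∨ y = k + 1) with hy' | rfl
    · rw [h.1.2 x y hxy hy', ← alternate_filter_ne (a := k + 1)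
        (w := l ++ (k + 1) :: k :: (k + 1) :: r) (by omega) (by omega),
        filter_ne_insertion (by omega) hl hr]
    · have key := alternate_split_two (a := k + 1) (b := x) (by omega) hl
        (m := [k]) (by simp) hr
      rw [alternate_comm]
      rw [List.singleton_append] at key
      rw [key]
      have h2 := h.count_le_two x
      rw [List.count_append, List.count_cons] at h2
      by_cases hx : x = k
      · subst hx
        simp at h2 ⊢
        omega
      · have : ¬ k = x := fun e => hx e.symm
        simp [hx, this]
  · have := h.2
    simp at this ⊢
    omega

/-! ### The recursion, for any property `Q` stable under insertion -/

/-- The minimal representants of the path on `k + 1` vertices that satisfy `Q`. -/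
def minReps (Q : List ℕ → Prop) (k : ℕ) : Set (List ℕ) :=
  {w | MinPathRep (k + 1) w ∧ Q w}

/-- The minimal representants of the path on `k + 1` vertices that satisfy `Q` and in which the
last vertex occurs twice. -/
def minRepsDouble (Q : List ℕ → Prop) (k : ℕ) : Set (List ℕ) :=
  {w | MinPathRep (k + 1) w ∧ Q w ∧ w.count k = 2}

/-- The pairs of words between which an occurrence of the last vertex stands in a minimal
representant of the path on `k + 1` vertices that satisfies `Q`. -/
def minRepsMarked (Q : List ℕ → Prop) (k : ℕ) : Set (List ℕ × List ℕ) :=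
  {p | MinPathRep (k + 1) (p.1 ++ k :: p.2) ∧ Q (p.1 ++ k :: p.2)}

lemma append_cons_inj_of_notMem_left {V : Type*} {a : V} {l l' r r' : List V} (hl : a ∉ l)
    (hl' : a ∉ l') (h : l ++ a :: r = l' ++ a :: r') : l = l' ∧ r = r' := by
  rcases List.append_eq_append_iff.1 h with ⟨s, rfl, h⟩ | ⟨s, rfl, h⟩ <;>
    rcases s with _ | ⟨b, s⟩ <;> simp_all

lemma append_cons_inj_of_notMem_right {V : Type*} {a : V} {l l' r r' : List V} (hr : a ∉ r)
    (hr' : a ∉ r') (h : l ++ a :: r = l' ++ a :: r') : l = l' ∧ r = r' := by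
  have := append_cons_inj_of_notMem_left (l := r.reverse) (l' := r'.reverse)
    (r := l.reverse) (r' := l'.reverse) (by simpa using hr) (by simpa using hr')
    (by simpa using congrArg List.reverse h)
  simpa [and_comm] using this

lemma encard_minRepsDouble_eq_encard_marked {Q : List ℕ → Prop} {k : ℕ}
    (hQ : ∀ l r, Q (l ++ (k + 1) :: k :: (k + 1) :: r) ↔ Q (l ++ k :: r)) :
    (minRepsDouble Q (k + 1)).encard = (minRepsMarked Q k).encard := by
  have hnot : ∀ p ∈ minRepsMarked Q k, k + 1 ∉ p.1 ∧ k + 1 ∉ p.2 := by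
    intro p hp
    have := hp.1.1.1 (k + 1)
    simp at this
    exact this
  have himg : minRepsDouble Q (k + 1) =
      (fun p : List ℕ × List ℕ => p.1 ++ (k + 1) :: k :: (k + 1) :: p.2) '' minRepsMarked Q k := by
    ext w
    constructor
    · rintro ⟨hw, hq, hc⟩
      obtain ⟨l, r, hlr, rfl⟩ := hw.exists_insertion hc
      exact ⟨(l, r), ⟨hlr, (hQ l r).1 hq⟩, rfl⟩
    · rintro ⟨⟨l, r⟩, hp, rfl⟩
      have hn := hnot _ hp
      refine ⟨hp.1.insertion, (hQ l r).2 hp.2, ?_⟩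
      simp [List.count_eq_zero.2 hn.1, List.count_eq_zero.2 hn.2]
  rw [himg, Set.InjOn.encard_image]
  intro p hp q hq h
  obtain ⟨h1, h2⟩ := append_cons_inj_of_notMem_left (hnot p hp).1 (hnot q hq).1 h
  exact Prod.ext h1 (by simpa using h2)

/-- Each word has one first occurrence of `k` to mark; a second one exists exactly when `k` is
doubled. -/
lemma encard_minRepsMarked (Q : List ℕ → Prop) (k : ℕ) :
    (minRepsMarked Q k).encard = (minReps Q k).encard + (minRepsDouble Q k).encard := by
  have hcount : ∀ p : List ℕ × List ℕ,
      (p.1 ++ k :: p.2).count k = p.1.count k + p.2.count k + 1 := by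
    intro p
    simp [List.count_append]
    omega
  have hunion : minRepsMarked Q k = {p ∈ minRepsMarked Q k | k ∉ p.1} ∪
      {p ∈ minRepsMarked Q k | k ∈ p.1} := by
    ext p
    simp only [Set.mem_union, Set.mem_ofPred_eq]
    tauto
  have hright : ∀ p ∈ {p ∈ minRepsMarked Q k | k ∈ p.1}, p.1.count k = 1 ∧ k ∉ p.2 := by
    rintro p ⟨hp, hk⟩
    have h1 := hp.1.count_le_two k
    rw [hcount] at h1
    have h2 := List.count_pos_iff.2 hk
    exact ⟨by omega, List.count_eq_zero.1 (by omega)⟩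
  have hfirst : minReps Q k =
      (fun p : List ℕ × List ℕ => p.1 ++ k :: p.2) '' {p ∈ minRepsMarked Q k | k ∉ p.1} := by
    ext w
    constructor
    · rintro ⟨hw, hq⟩
      obtain ⟨l, r, rfl, hl⟩ := List.eq_append_cons_of_mem ((hw.1.1 k).2 (by omega))
      exact ⟨(l, r), ⟨⟨hw, hq⟩, hl⟩, rfl⟩
    · rintro ⟨p, ⟨hp, -⟩, rfl⟩
      exact hp
  have hsecond : minRepsDouble Q k =
      (fun p : List ℕ × List ℕ => p.1 ++ k :: p.2) '' {p ∈ minRepsMarked Q k | k ∈ p.1} := by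
    ext w
    constructor
    · rintro ⟨hw, hq, hc⟩
      obtain ⟨l, m, r, rfl, -, -, -⟩ := exists_split_of_count_eq_two hc
      have e : l ++ k :: (m ++ k :: r) = (l ++ k :: m) ++ k :: r := by simp
      rw [e] at hw hq ⊢
      exact ⟨(l ++ k :: m, r), ⟨⟨hw, hq⟩, by simp⟩, rfl⟩
    · rintro ⟨p, hp, rfl⟩
      have h1 := hright p hp
      refine ⟨hp.1.1, hp.1.2, ?_⟩
      have h2 := hcount p
      rw [List.count_eq_zero.2 h1.2] at h2
      simp only
      omega
  rw [hunion, Set.encard_union_eq, hfirst, hsecond, Set.InjOn.encard_image, Set.InjOn.encard_image]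
  · intro p hp q hq h
    obtain ⟨h1, h2⟩ := append_cons_inj_of_notMem_right (hright p hp).2 (hright q hq).2 h
    exact Prod.ext h1 h2
  · intro p hp q hq h
    obtain ⟨h1, h2⟩ := append_cons_inj_of_notMem_left hp.2 hq.2 h
    exact Prod.ext h1 h2
  · rw [Set.disjoint_left]
    rintro p ⟨-, h1⟩ ⟨-, h2⟩
    exact h1 h2

lemma encard_minRepsDouble_succ {Q : List ℕ → Prop} {k : ℕ}
    (hQ : ∀ l r, Q (l ++ (k + 1) :: k :: (k + 1) :: r) ↔ Q (l ++ k :: r)) :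
    (minRepsDouble Q (k + 1)).encard = (minReps Q k).encard + (minRepsDouble Q k).encard := by
  rw [encard_minRepsDouble_eq_encard_marked hQ, encard_minRepsMarked]

/-! ### Words with a single end vertex -/

/-- The first two vertices of the path occur once each. -/
def FirstSingle (w : List ℕ) : Prop := w.count 0 = 1 ∧ w.count 1 = 1

/-- For `k = 0` the inserted letter would be `1` itself, changing a count that `FirstSingle` fixes.
-/
lemma firstSingle_insertion {k : ℕ} (hk : 1 ≤ k) (l r : List ℕ) :
    FirstSingle (l ++ (k + 1) :: k :: (k + 1) :: r) ↔ FirstSingle (l ++ k :: r) := by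
  have h : ¬ k = 0 := by omega
  simp [FirstSingle, List.count_append, List.count_cons, h]

lemma minPathRep_two_iff {w : List ℕ} : MinPathRep 2 w ↔ w = [0, 1] ∨ w = [1, 0] := by
  constructor
  · rintro ⟨h, hlen⟩
    obtain ⟨a, b, rfl⟩ := List.length_eq_two.1 (by omega : w.length = 2)
    have h0 := (h.1 0).2 (by omega)
    have h1 := (h.1 1).2 (by omega)
    simp at h0 h1 ⊢
    omega
  · intro h
    refine ⟨⟨?_, ?_⟩, ?_⟩
    · intro v
      rcases h with rfl | rfl <;> simp <;> omega
    · intro x y hxy hy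
      obtain rfl : x = 0 := by omega
      obtain rfl : y = 1 := by omega
      refine iff_of_true rfl (alternate_of_count_eq_one (by omega) ?_ ?_) <;>
        rcases h with rfl | rfl <;> rfl
    · rcases h with rfl | rfl <;> rfl

lemma minReps_one {Q : List ℕ → Prop} (hQ : Q [0, 1] ∧ Q [1, 0]) : (minReps Q 1).encard = 2 := by
  have : minReps Q 1 = {[0, 1], [1, 0]} := by
    ext w
    simp only [minReps, Set.mem_ofPred_eq, Set.mem_insert_iff, Set.mem_singleton_iff,
      Nat.reduceAdd, minPathRep_two_iff]
    constructor
    · exact fun h => h.1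
    · rintro (rfl | rfl)
      · exact ⟨Or.inl rfl, hQ.1⟩
      · exact ⟨Or.inr rfl, hQ.2⟩
  rw [this, Set.encard_pair (by simp)]

lemma minRepsDouble_one (Q : List ℕ → Prop) : minRepsDouble Q 1 = ∅ := by
  ext w
  simp only [minRepsDouble, Set.mem_ofPred_eq, Set.mem_empty_iff_false, iff_false,
    Nat.reduceAdd, minPathRep_two_iff]
  rintro ⟨rfl | rfl, -, h⟩ <;> simp at h

/-- A single last vertex would be adjacent to the single vertex `0`, but it is at distance at least
two. -/
lemma minReps_firstSingle_eq_double (k : ℕ) :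
    minReps FirstSingle (k + 2) = minRepsDouble FirstSingle (k + 2) := by
  ext w
  refine ⟨fun ⟨hw, hq⟩ => ⟨hw, hq, ?_⟩, fun ⟨hw, hq, _⟩ => ⟨hw, hq⟩⟩
  have h1 := hw.count_le_two (k + 2)
  have h2 := hw.1.count_pos (v := k + 2) (by omega)
  by_contra hne
  have := hw.1.succ_eq_of_count_eq_one (x := 0) (y := k + 2) (by omega) (by omega) hq.1 (by omega)
  omega

lemma encard_minReps_firstSingle (k : ℕ) :
    (minReps FirstSingle (k + 2)).encard = ((2 ^ (k + 1) : ℕ) : ℕ∞) := by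
  induction k with
  | zero =>
    rw [minReps_firstSingle_eq_double, encard_minRepsDouble_succ (firstSingle_insertion le_rfl),
      minReps_one (by simp [FirstSingle]), minRepsDouble_one]
    simp
  | succ k ih =>
    rw [minReps_firstSingle_eq_double,
      encard_minRepsDouble_succ (firstSingle_insertion (by omega)),
      ← minReps_firstSingle_eq_double, ih, ← Nat.cast_add]
    congr 1
    ring

/-- The reflection of the path on the vertices `0, …, k`, extended by the identity. -/
def reflect (k i : ℕ) : ℕ := if i ≤ k then k - i else i

lemma reflect_involutive (k : ℕ) : Function.Involutive (reflect k) := by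
  intro i
  unfold reflect
  split_ifs <;> omega

lemma MinPathRep.map_reflect {k : ℕ} {w : List ℕ} (h : MinPathRep (k + 1) w) :
    MinPathRep (k + 1) (w.map (reflect k)) := by
  have hinv := reflect_involutive k
  refine ⟨⟨?_, ?_⟩, by simpa using h.2⟩
  · intro v
    rw [← hinv v, List.mem_map_of_injective hinv.injective, h.1.1, hinv v]
    unfold reflect
    split_ifs <;> omega
  · intro x y hxy hy
    rw [← hinv x, ← hinv y, alternate_map hinv.injective, hinv x, hinv y, alternate_comm,
      ← h.1.2 (reflect k y) (reflect k x)] <;>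
    · unfold reflect
      split_ifs <;> omega

lemma count_map_reflect (k v : ℕ) (w : List ℕ) :
    (w.map (reflect k)).count v = w.count (reflect k v) := by
  conv_lhs => rw [← reflect_involutive k v]
  exact List.count_map_of_injective _ _ (reflect_involutive k).injective _

/-- The minimal representants in which the last vertex occurs once are the reflections of those
in which the first two vertices occur once. -/
lemma image_reflect_minReps_firstSingle (k : ℕ) :
    List.map (reflect (k + 1)) '' minReps FirstSingle (k + 1) =
      minReps (fun w => w.count (k + 1) = 1) (k + 1) := by
  have hinv := reflect_involutive (k + 1)
  ext w
  constructor
  · rintro ⟨u, ⟨hu, hq⟩, rfl⟩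
    refine ⟨hu.map_reflect, ?_⟩
    simpa [count_map_reflect, reflect] using hq.1
  · rintro ⟨hw, hq⟩
    refine ⟨w.map (reflect (k + 1)), ⟨hw.map_reflect, ?_, ?_⟩, ?_⟩
    · rw [count_map_reflect]
      simpa [reflect] using hq
    · obtain ⟨p, hp, hp1, hp2⟩ := hw.exists_singles
      have := hw.1.succ_eq_of_count_eq_one (x := p) (y := k + 1) (by omega) (by omega) hp1 hq
      obtain rfl : p = k := by omega
      rw [count_map_reflect]
      simpa [reflect] using hp1
    · rw [List.map_map, hinv.comp_self, List.map_id]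

lemma encard_minReps_lastSingle (k : ℕ) :
    (minReps (fun w => w.count (k + 2) = 1) (k + 2)).encard = ((2 ^ (k + 1) : ℕ) : ℕ∞) := by
  rw [← image_reflect_minReps_firstSingle, ← encard_minReps_firstSingle]
  exact (List.map_injective_iff.2 (reflect_involutive _).injective).encard_image _

/-! ### Solving the recursion -/

lemma encard_minReps_eq_add (k : ℕ) : (minReps (fun _ => True) k).encard =
    (minReps (fun w => w.count k = 1) k).encard + (minRepsDouble (fun _ => True) k).encard := by
  rw [← Set.encard_union_eq]
  · congr 1
    ext w
    simp only [minReps, minRepsDouble, Set.mem_union, Set.mem_ofPred_eq, true_and, and_true]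
    refine ⟨fun hw => ?_, fun h => h.elim And.left And.left⟩
    have h1 := hw.count_le_two k
    have h2 := hw.1.count_pos (v := k) (by omega)
    rcases (by omega : w.count k = 1 ∨ w.count k = 2) with h | h
    · exact Or.inl ⟨hw, h⟩
    · exact Or.inr ⟨hw, h⟩
  · rw [Set.disjoint_left]
    rintro w ⟨-, h1⟩ ⟨-, -, h2⟩
    exact absurd (h1.symm.trans h2) (by omega)

lemma encard_minRepsDouble (k : ℕ) :
    (minRepsDouble (fun _ => True) (k + 2)).encard = (((k + 2) * 2 ^ k : ℕ) : ℕ∞) := by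
  induction k with
  | zero =>
    rw [encard_minRepsDouble_succ (fun _ _ => Iff.rfl), minReps_one ⟨trivial, trivial⟩,
      minRepsDouble_one]
    simp
  | succ k ih =>
    rw [encard_minRepsDouble_succ (fun _ _ => Iff.rfl), encard_minReps_eq_add,
      encard_minReps_lastSingle, ih, ← Nat.cast_add, ← Nat.cast_add]
    congr 1
    ring

lemma encard_minPathRep (k : ℕ) :
    {w | MinPathRep (k + 3) w}.encard = (((k + 4) * 2 ^ k : ℕ) : ℕ∞) := by
  have : {w | MinPathRep (k + 3) w} = minReps (fun _ => True) (k + 2) := by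
    simp [minReps]
  rw [this, encard_minReps_eq_add, encard_minReps_lastSingle, encard_minRepsDouble, ← Nat.cast_add]
  congr 1
  ring

/-! ### Transfer to `SimpleGraph.pathGraph` -/

lemma represents_pathGraph_iff {k : ℕ} (w : List (Fin k)) :
    Represents w (SimpleGraph.pathGraph k) ↔ PathRep k (w.map Fin.val) := by
  constructor
  · rintro ⟨h1, h2⟩
    refine ⟨fun v => ⟨?_, fun hv => ?_⟩, fun x y hxy hy => ?_⟩
    · intro hv
      obtain ⟨i, -, rfl⟩ := List.mem_map.1 hv
      exact i.2
    · exact List.mem_map.2 ⟨⟨v, hv⟩, h1 _, rfl⟩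
    · have := h2 ⟨x, hxy.trans hy⟩ ⟨y, hy⟩ (by simp [Fin.ext_iff, hxy.ne])
      rw [← alternate_map Fin.val_injective, SimpleGraph.pathGraph_adj] at this
      rw [← this]
      simp only
      omega
  · rintro ⟨h1, h2⟩
    have key : ∀ x y : Fin k, x < y →
        ((SimpleGraph.pathGraph k).Adj x y ↔ Alternate w x y) := by
      intro x y hxy
      rw [← alternate_map Fin.val_injective, ← h2 x y hxy y.2, SimpleGraph.pathGraph_adj]
      have : x.val < y.val := hxy
      omega
    refine ⟨fun v => ?_, fun x y hxy => ?_⟩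
    · exact (List.mem_map_of_injective Fin.val_injective).1 ((h1 v).2 v.2)
    · rcases hxy.lt_or_gt with h | h
      · exact key x y h
      · rw [SimpleGraph.adj_comm, alternate_comm]
        exact key y x h

lemma PathRep.exists_map_val {k : ℕ} {w : List ℕ} (h : PathRep k w) :
    ∃ u : List (Fin k), u.map Fin.val = w :=
  ⟨w.pmap Fin.mk fun v hv => (h.1 v).1 hv, by simp [List.map_pmap]⟩

lemma minLength_pathGraph {k : ℕ} {w : List (Fin k)} (hw : MinPathRep k (w.map Fin.val)) :
    minLength (SimpleGraph.pathGraph k) = 2 * k - 2 := by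
  have hlen := hw.2
  rw [List.length_map] at hlen
  refine (IsLeast.csInf_eq ⟨⟨w, (represents_pathGraph_iff w).2 hw.1, by omega⟩, ?_⟩)
  rintro m ⟨u, hu, rfl⟩
  have := ((represents_pathGraph_iff u).1 hu).le_length
  rw [List.length_map] at this
  omega

end WordRep

theorem mainTheorem5 (k : ℕ) (hk : 3 ≤ k) :
    (∃ w : List (Fin k), WordRep.Represents w (SimpleGraph.pathGraph k)) ∧
      WordRep.numMinReps (SimpleGraph.pathGraph k) = (k + 1) * 2 ^ (k - 3) := by
  obtain ⟨n, rfl⟩ := Nat.exists_eq_add_of_le' hk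
  have hcard := WordRep.encard_minPathRep n
  obtain ⟨w, hw⟩ : {w | WordRep.MinPathRep (n + 3) w}.Nonempty := by
    rw [← Set.encard_ne_zero, hcard]
    exact_mod_cast (by positivity : (n + 4) * 2 ^ n ≠ 0)
  obtain ⟨u, rfl⟩ := hw.1.exists_map_val
  refine ⟨⟨u, (WordRep.represents_pathGraph_iff u).2 hw.1⟩, ?_⟩
  have himg : {w | WordRep.MinPathRep (n + 3) w} = List.map Fin.val ''
      {w : List (Fin (n + 3)) | WordRep.Represents w (SimpleGraph.pathGraph (n + 3)) ∧
        w.length = WordRep.minLength (SimpleGraph.pathGraph (n + 3))} := by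
    rw [WordRep.minLength_pathGraph hw]
    ext v
    constructor
    · intro hv
      obtain ⟨t, rfl⟩ := hv.1.exists_map_val
      have hlen := hv.2
      rw [List.length_map] at hlen
      exact ⟨t, ⟨(WordRep.represents_pathGraph_iff t).2 hv.1, by omega⟩, rfl⟩
    · rintro ⟨t, ⟨ht, hlen⟩, rfl⟩
      refine ⟨(WordRep.represents_pathGraph_iff t).1 ht, ?_⟩
      rw [List.length_map]
      omega
  rw [himg, (List.map_injective_iff.2 Fin.val_injective).encard_image] at hcard
  rw [WordRep.numMinReps, Set.ncard, hcard, ENat.toNat_natCast]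
  rfl
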